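/- For a finite abelian group $G$, let the group cone $\mathcal C(G)$ be the set of $x \in \mathbb R^{G}$ with $x_0 = 0$ and $x_i + x_j \ge x_{i+j}$ for all $i, j \in G\setminus\{0\}$ with $i + j \ne 0$; if $|G| = 2$ these inequalities are replaced by $x_i \ge 0$ for the nonzero $i \in G$. The facets of $\mathcal C(G)$ are obtained by turning one of these inequalities into an equation, and a face of $\mathcal C(G)$ is the intersection of $\mathcal C(G)$ with some (possibly empty) collection of facets. For a face $F$ of $\mathcal C(G)$, the Kunz subgroup of $F$ is $K = \{g \in G : x_g = 0 \text{ for all } x \in F\}$, and the Kunz poset of $F$ is $G/K$ with the partial order $\bar a \preceq \bar b$ if and only if $x_a + x_{b-a} = x_b$ for all $x \in F$. Let $H$ be a subgroup of $G$ such that $G/H$ is cyclic, let $\rho \in G$ map to a generator of $G/H$, and let $\beta = |G/H|$. Every element of $G$ is uniquely of the form $a + b\rho$ with $a \in H$ and $0 \le b < \beta$; define the linear map $\Phi_\rho : \mathcal C(H) \to \mathcal C(G)$, $w \mapsto x$, by $x_{a + b\rho} = \beta w_a + b\, w_{\beta\rho}$ for $a \in H$, $0 \le b < \beta$. Then the image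 $\Phi_\rho(\mathcal C(H))$ is a face of $\mathcal C(G)$. More precisely, let $F$ be any face of $\mathcal C(H)$, with Kunz subgroup $H' \subseteq H$ and Kunz poset $P = (H/H', \preceq_P)$. Then $\Phi_\rho(F)$ is a face of $\mathcal C(G)$, and its Kunz poset is the augmented monoscopic extension $Q$ of $P$ along $\rho$, that is: (i) if $\beta\rho \notin H'$, then $Q$ has ground set $G/H'$ and, for $a, a' \in H$ and $0 \le b, b' < \beta$, one has $\overline{a + b\rho} \preceq_Q \overline{a' + b'\rho}$ if and only if $\bar a \preceq_P \bar a'$ and ($b \le b'$ or $\overline{\beta\rho} \preceq_P \bar a' - \bar a$); (ii) if $\beta\rho \in H'$, then $Q$ has ground set $G/(H' + \langle\rho\rangle)$ and its order is that of $P$ under the natural isomorphism $H/H' \cong G/(H' + \langle\rho\rangle)$. -/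

import Mathlib

/-! ### The group cone -/

/-- The pairs `(i, j)` indexing the facet inequalities `x i + x j ≥ x (i + j)` of the group cone.
If `|G| = 2` there is no pair of nonzero elements with nonzero sum, and the cone is the half-line
`x ≥ 0`, cut out by the pair `(i, i)` with `i` the nonzero element (remember `x 0 = 0`). -/
def IsFacetPair {G : Type*} [AddCommGroup G] (i j : G) : Prop :=
  i ≠ 0 ∧ j ≠ 0 ∧ (i + j ≠ 0 ∨ Nat.card G = 2)

/-- The group cone `C(G)`, with a coordinate `x 0 = 0` prepended to every point. -/
def groupCone (G : Type*) [AddCommGroup G] : Set (G → ℝ) :=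
  {x | x 0 = 0 ∧ ∀ i j : G, IsFacetPair i j → x (i + j) ≤ x i + x j}

/-- The facet of `C(G)` given by the pair `(i, j)`. -/
def groupConeFacet {G : Type*} [AddCommGroup G] (i j : G) : Set (G → ℝ) :=
  {x | x ∈ groupCone G ∧ x i + x j = x (i + j)}

/-- A face of `C(G)`: the intersection of `C(G)` with some collection of its facets. -/
structure GroupConeFace (G : Type*) [AddCommGroup G] where
  /-- the points of the face -/
  carrier : Set (G → ℝ)
  isFace : ∃ I : Set (G × G), (∀ p ∈ I, IsFacetPair p.1 p.2) ∧
    carrier = {x | x ∈ groupCone G ∧ ∀ p ∈ I, x ∈ groupConeFacet p.1 p.2}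

theorem GroupConeFace.mem_cone {G : Type*} [AddCommGroup G] (F : GroupConeFace G)
    {x : G → ℝ} (hx : x ∈ F.carrier) : x ∈ groupCone G := by
  obtain ⟨I, _, h⟩ := F.isFace
  rw [h] at hx
  exact hx.1

theorem groupCone_nonneg {G : Type*} [AddCommGroup G] [Finite G] {x : G → ℝ}
    (hx : x ∈ groupCone G) (g : G) : 0 ≤ x g := by
  obtain ⟨i, hi⟩ := Finite.exists_min x
  refine le_trans ?_ (hi g)
  by_cases h0 : i = 0
  · rw [h0, hx.1]
  by_cases h2 : i + i = 0
  · by_cases hc : Nat.card G = 2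
    · have := hx.2 i i ⟨h0, h0, Or.inr hc⟩
      rw [h2, hx.1] at this
      linarith
    · obtain ⟨j, hj0, hji⟩ : ∃ j : G, j ≠ 0 ∧ j ≠ i := by
        by_contra! hcon
        apply hc
        rw [Nat.card_eq_two_iff]
        refine ⟨0, i, fun h => h0 h.symm, ?_⟩
        ext j
        by_cases hj : j = 0
        · simp [hj]
        · simp [hcon j hj]
      have hij : i + j ≠ 0 := by
        intro h
        apply hji
        have : i + j = i + i := by rw [h, h2]
        exact add_left_cancel this
      have hiij : i + (i + j) = j := by rw [← add_assoc, h2, zero_add]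
      have e1 := hx.2 i j ⟨h0, hj0, Or.inl hij⟩
      have e2 := hx.2 i (i + j) ⟨h0, hij, Or.inl (by rw [hiij]; exact hj0)⟩
      rw [hiij] at e2
      linarith
  · have e1 := hx.2 i i ⟨h0, h0, Or.inl h2⟩
    have e2 := hi (i + i)
    linarith

theorem groupCone_subadd {G : Type*} [AddCommGroup G] [Finite G] {x : G → ℝ}
    (hx : x ∈ groupCone G) (i j : G) : x (i + j) ≤ x i + x j := by
  by_cases hi : i = 0
  · simp [hi, hx.1]
  by_cases hj : j = 0
  · simp [hj, hx.1]
  by_cases hij : i + j = 0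
  · rw [hij, hx.1]
    exact add_nonneg (groupCone_nonneg hx i) (groupCone_nonneg hx j)
  · exact hx.2 i j ⟨hi, hj, Or.inl hij⟩

/-! ### The Kunz subgroup and the Kunz poset of a face -/

/-- The Kunz subgroup of a face. -/
def GroupConeFace.kunzSubgroup {G : Type*} [AddCommGroup G] [Finite G] (F : GroupConeFace G) :
    AddSubgroup G where
  carrier := {h | ∀ x ∈ F.carrier, x h = 0}
  zero_mem' := fun _ hx => (F.mem_cone hx).1
  add_mem' := by
    intro a b ha hb x hx
    have h1 := groupCone_subadd (F.mem_cone hx) a b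
    have h2 := groupCone_nonneg (F.mem_cone hx) (a + b)
    rw [ha x hx, hb x hx] at h1
    linarith
  neg_mem' := by
    intro a ha x hx
    have key : ∀ n : ℕ, x (n • a) = 0 := by
      intro n
      induction n with
      | zero => simpa using (F.mem_cone hx).1
      | succ k ih =>
        have h1 := groupCone_subadd (F.mem_cone hx) (k • a) a
        have h2 := groupCone_nonneg (F.mem_cone hx) (k • a + a)
        rw [ih, ha x hx] at h1
        rw [succ_nsmul]
        linarith
    have hpos : 0 < addOrderOf a := addOrderOf_pos a
    have : -a = (addOrderOf a - 1) • a := by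
      have h : (addOrderOf a - 1) • a + a = 0 := by
        rw [← succ_nsmul, Nat.sub_add_cancel hpos, addOrderOf_nsmul_eq_zero]
      exact (eq_neg_of_add_eq_zero_left h).symm
    rw [this]
    exact key _

theorem GroupConeFace.apply_congr {G : Type*} [AddCommGroup G] [Finite G] (F : GroupConeFace G)
    {x : G → ℝ} (hx : x ∈ F.carrier) {a b : G}
    (h : (a : G ⧸ F.kunzSubgroup) = (b : G ⧸ F.kunzSubgroup)) : x a = x b := by
  have hab : -a + b ∈ F.kunzSubgroup := QuotientAddGroup.eq.mp h
  have h1 := groupCone_subadd (F.mem_cone hx) a (-a + b)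
  have h2 := groupCone_subadd (F.mem_cone hx) b (-(-a + b))
  rw [hab x hx, add_neg_cancel_left] at h1
  have e : b + -(-a + b) = a := by abel
  rw [(F.kunzSubgroup.neg_mem hab) x hx, e] at h2
  linarith

/-- The relation of the Kunz poset on representatives. -/
def GroupConeFace.Rel {G : Type*} [AddCommGroup G] (F : GroupConeFace G) (a b : G) : Prop :=
  ∀ x ∈ F.carrier, x a + x (b - a) = x b

theorem GroupConeFace.rel_congr {G : Type*} [AddCommGroup G] [Finite G] (F : GroupConeFace G)
    {a b a' b' : G} (ha : (a : G ⧸ F.kunzSubgroup) = (a' : G ⧸ F.kunzSubgroup))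
    (hb : (b : G ⧸ F.kunzSubgroup) = (b' : G ⧸ F.kunzSubgroup)) (h : F.Rel a b) :
    F.Rel a' b' := by
  intro x hx
  have hba : ((b - a : G) : G ⧸ F.kunzSubgroup) = ((b' - a' : G) : G ⧸ F.kunzSubgroup) := by
    rw [QuotientAddGroup.mk_sub, QuotientAddGroup.mk_sub, ha, hb]
  rw [← F.apply_congr hx ha, ← F.apply_congr hx hb, ← F.apply_congr hx hba]
  exact h x hx

/-- The Kunz poset of a face `F` with Kunz subgroup `K`: the partial order on `G ⧸ K` in which
the class of `a` lies below the class of `b` iff `x a + x (b - a) = x b` on all of `F`. -/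
@[reducible]
def GroupConeFace.kunzPoset {G : Type*} [AddCommGroup G] [Finite G] (F : GroupConeFace G) :
    PartialOrder (G ⧸ F.kunzSubgroup) where
  le p q := ∃ a b : G, p = a ∧ q = b ∧ F.Rel a b
  le_refl p := by
    induction p using QuotientAddGroup.induction_on with
    | H a =>
      refine ⟨a, a, rfl, rfl, fun x hx => ?_⟩
      rw [sub_self, (F.mem_cone hx).1, add_zero]
  le_trans := by
    rintro p q r ⟨a, b, rfl, rfl, hab⟩ ⟨b', c, hb, rfl, hbc'⟩
    have hbc : F.Rel b c := F.rel_congr hb.symm rfl hbc'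
    refine ⟨a, c, rfl, rfl, fun x hx => ?_⟩
    have h1 := hab x hx
    have h2 := hbc x hx
    have h3 := groupCone_subadd (F.mem_cone hx) a (c - a)
    have h4 := groupCone_subadd (F.mem_cone hx) (b - a) (c - b)
    have e3 : a + (c - a) = c := by abel
    have e4 : (b - a) + (c - b) = c - a := by abel
    rw [e3] at h3
    rw [e4] at h4
    linarith
  le_antisymm := by
    rintro p q ⟨a, b, rfl, rfl, hab⟩ ⟨b', a', hb, ha, hba'⟩
    have hba : F.Rel b a := F.rel_congr hb.symm ha.symm hba'
    rw [QuotientAddGroup.eq]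
    intro x hx
    have h1 := hab x hx
    have h2 := hba x hx
    have h3 := groupCone_nonneg (F.mem_cone hx) (b - a)
    have h4 := groupCone_nonneg (F.mem_cone hx) (a - b)
    have e : -a + b = b - a := by abel
    rw [e]
    linarith

/-! ### The monoscopic embedding

`H` is a subgroup of `G`, `β = H.index = |G / H|`, and the class of `ρ` generates `G / H`. -/

theorem exists_monoscopic_decomp {G : Type*} [AddCommGroup G] [Finite G] {H : AddSubgroup G}
    {ρ : G} (hρ : AddSubgroup.zmultiples (ρ : G ⧸ H) = ⊤) (g : G) :
    ∃ p : H × ℕ, p.2 < H.index ∧ g = (p.1 : G) + p.2 • ρ := by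
  have hg : (g : G ⧸ H) ∈ AddSubgroup.zmultiples (ρ : G ⧸ H) := by rw [hρ]; trivial
  have hcard : addOrderOf (ρ : G ⧸ H) = H.index := by
    rw [← Nat.card_zmultiples, hρ, AddSubgroup.card_top, AddSubgroup.index]
  classical
  rw [mem_zmultiples_iff_mem_range_addOrderOf] at hg
  obtain ⟨b, hb, hbg⟩ := Finset.mem_image.mp hg
  rw [Finset.mem_range, hcard] at hb
  have hbg' : b • (ρ : G ⧸ H) = (g : G ⧸ H) := hbg
  rw [← QuotientAddGroup.mk_nsmul, QuotientAddGroup.eq] at hbg'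
  exact ⟨(⟨_, hbg'⟩, b), hb, by simp⟩

/-- The element `a ∈ H` in the unique expression `g = a + b ρ` with `a ∈ H` and `0 ≤ b < β`. -/
noncomputable def monoscopicA {G : Type*} [AddCommGroup G] [Finite G] {H : AddSubgroup G}
    {ρ : G} (hρ : AddSubgroup.zmultiples (ρ : G ⧸ H) = ⊤) (g : G) : H :=
  (exists_monoscopic_decomp hρ g).choose.1

/-- The number `b` in the unique expression `g = a + b ρ` with `a ∈ H` and `0 ≤ b < β`. -/
noncomputable def monoscopicB {G : Type*} [AddCommGroup G] [Finite G] {H : AddSubgroup G}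
    {ρ : G} (hρ : AddSubgroup.zmultiples (ρ : G ⧸ H) = ⊤) (g : G) : ℕ :=
  (exists_monoscopic_decomp hρ g).choose.2

/-- The element `β ρ` of `H`. -/
noncomputable def betaRho {G : Type*} [AddCommGroup G] (H : AddSubgroup G) (ρ : G) : H :=
  ⟨H.index • ρ, H.nsmul_index_mem ρ⟩

/-- The monoscopic embedding `w ↦ x`, `x (a + b ρ) = β w a + b w (β ρ)` for `a ∈ H` and
`0 ≤ b < β`, as a linear map on the ambient coordinate spaces. -/
noncomputable def monoscopicEmbedding {G : Type*} [AddCommGroup G] [Finite G]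
    {H : AddSubgroup G} {ρ : G} (hρ : AddSubgroup.zmultiples (ρ : G ⧸ H) = ⊤) :
    (H → ℝ) →ₗ[ℝ] (G → ℝ) where
  toFun w g := (H.index : ℝ) * w (monoscopicA hρ g) + (monoscopicB hρ g : ℝ) * w (betaRho H ρ)
  map_add' w w' := by
    ext g
    simp only [Pi.add_apply]
    ring
  map_smul' c w := by
    ext g
    simp only [Pi.smul_apply, smul_eq_mul, RingHom.id_apply]
    ring

/-- The defining formula of the monoscopic embedding. -/
theorem monoscopicEmbedding_apply {G : Type*} [AddCommGroup G] [Finite G]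
    {H : AddSubgroup G} {ρ : G} (hρ : AddSubgroup.zmultiples (ρ : G ⧸ H) = ⊤) (w : H → ℝ)
    (a : H) (b : ℕ) (hb : b < H.index) :
    monoscopicEmbedding hρ w ((a : G) + b • ρ) =
      (H.index : ℝ) * w a + (b : ℝ) * w (betaRho H ρ) := by
  have hcard : addOrderOf (ρ : G ⧸ H) = H.index := by
    rw [← Nat.card_zmultiples, hρ, AddSubgroup.card_top, AddSubgroup.index]
  obtain ⟨h1, h2⟩ := (exists_monoscopic_decomp hρ ((a : G) + b • ρ)).choose_spec
  change monoscopicB hρ ((a : G) + b • ρ) < H.index at h1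
  change (a : G) + b • ρ = (monoscopicA hρ ((a : G) + b • ρ) : G) +
    monoscopicB hρ ((a : G) + b • ρ) • ρ at h2
  change (H.index : ℝ) * w (monoscopicA hρ ((a : G) + b • ρ)) +
    (monoscopicB hρ ((a : G) + b • ρ) : ℝ) * w (betaRho H ρ) = _
  generalize monoscopicA hρ ((a : G) + b • ρ) = a₁ at h1 h2 ⊢
  generalize monoscopicB hρ ((a : G) + b • ρ) = b₁ at h1 h2 ⊢
  have hq : b • (ρ : G ⧸ H) = b₁ • (ρ : G ⧸ H) := by
    have h := congrArg (fun g : G => (g : G ⧸ H)) h2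
    simpa [QuotientAddGroup.mk_add, (QuotientAddGroup.eq_zero_iff _).mpr a.2,
      (QuotientAddGroup.eq_zero_iff _).mpr a₁.2] using h
  have hbb : b = b₁ := nsmul_injOn_Iio_addOrderOf (by simpa [hcard] using hb)
    (by simpa [hcard] using h1) hq
  subst hbb
  have haa : a = a₁ := Subtype.ext (add_right_cancel h2)
  rw [haa]

/-! ### The augmented monoscopic extension of a poset on `H / H'`

The condition `β ρ = 0` is read in `H / H'`, that is, as `β ρ ∈ H'`. -/

open Classical in
/-- The subgroup `K` of `G` for which the augmented monoscopic extension lives on `G / K`: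
`H'` if `β ρ ≠ 0` in `H / H'`, and `H' + ⟨ρ⟩` if `β ρ = 0` in `H / H'`. -/
noncomputable def augmentedSubgroup {G : Type*} [AddCommGroup G] {H : AddSubgroup G}
    (H' : AddSubgroup H) (ρ : G) : AddSubgroup G :=
  if betaRho H ρ ∈ H' then H'.map H.subtype ⊔ AddSubgroup.zmultiples ρ else H'.map H.subtype

open Classical in
/-- The order relation of the augmented monoscopic extension along `ρ` of a poset `P` on `H / H'`.
If `β ρ = 0` in `H / H'`, it is the image of `P` under the natural isomorphism
`H / H' ≅ G / (H' + ⟨ρ⟩)`. -/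
def augmentedLE {G : Type*} [AddCommGroup G] {H : AddSubgroup G} {H' : AddSubgroup H}
    (P : PartialOrder (H ⧸ H')) (ρ : G) (p q : G ⧸ augmentedSubgroup H' ρ) : Prop :=
  if betaRho H ρ ∈ H' then
    ∃ a a' : H, p = ((a : G) : G ⧸ augmentedSubgroup H' ρ) ∧
      q = ((a' : G) : G ⧸ augmentedSubgroup H' ρ) ∧
      P.le (a : H ⧸ H') (a' : H ⧸ H')
  else
    ∃ (a a' : H) (b b' : ℕ), b < H.index ∧ b' < H.index ∧
      p = (((a : G) + b • ρ : G) : G ⧸ augmentedSubgroup H' ρ) ∧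
      q = (((a' : G) + b' • ρ : G) : G ⧸ augmentedSubgroup H' ρ) ∧
      P.le (a : H ⧸ H') (a' : H ⧸ H') ∧
      (b ≤ b' ∨ P.le (betaRho H ρ : H ⧸ H') ((a' - a : H) : H ⧸ H'))

/-! A point of `C(G)` lies in the image exactly when it is additive along `ρ`: `x (a + b ρ) = x a +
b x ρ` for `a ∈ H` and `0 ≤ b < β`, and `x (β ρ) = β x ρ`. Such a point is recovered from its
restriction to `H`, divided by `β`. Since additivity equations cut out faces, even for pairs that
index no facet (`exists_groupConeFace`), adding the equations of `F` makes the image of `F` a face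
(`exists_groupConeFace_image`). The Kunz data come from evaluating the formula: vanishing is decided
by nonnegativity of both summands, and the order by whether `b' - b` borrows a multiple `β ρ` from
`H` (`rel_add_nsmul_iff`). -/

/-! ### Faces cut out by arbitrary additivity equations -/

/-- Any collection of equations `x i + x j = x (i + j)` cuts out a face of the group cone. -/
theorem exists_groupConeFace {G : Type*} [AddCommGroup G] [Finite G] (I : Set (G × G)) :
    ∃ F : GroupConeFace G,
      F.carrier = {x | x ∈ groupCone G ∧ ∀ p ∈ I, x p.1 + x p.2 = x (p.1 + p.2)} := by
  set S : Set (G → ℝ) := {x | x ∈ groupCone G ∧ ∀ p ∈ I, x p.1 + x p.2 = x (p.1 + p.2)} with hS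
  -- All facet equations valid on `S`; it remains to see that they imply the given equations.
  let J : Set (G × G) :=
    {p | IsFacetPair p.1 p.2 ∧ ∀ y ∈ S, y p.1 + y p.2 = y (p.1 + p.2)}
  refine ⟨⟨S, J, fun p hp => hp.1, ?_⟩, rfl⟩
  ext x
  refine ⟨fun hx => ⟨hx.1, fun p hp => ⟨hx.1, hp.2 x hx⟩⟩, fun ⟨hx, hJ⟩ => ⟨hx, ?_⟩⟩
  rintro ⟨i, j⟩ hij
  dsimp only
  have hE : ∀ k l : G, IsFacetPair k l → (∀ y ∈ S, y k + y l = y (k + l)) →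
      x k + x l = x (k + l) := fun k l h h' => (hJ (k, l) ⟨h, h'⟩).2
  by_cases hi : i = 0
  · simp [hi, hx.1]
  by_cases hj : j = 0
  · simp [hj, hx.1]
  by_cases hf : IsFacetPair i j
  · exact hE i j hf fun y hy => hy.2 _ hij
  -- What remains is an opposite pair, whose equation forces `y i = y j = 0` on `S`. Points of `S`
  -- are then invariant under translation by `i` and `j`, which yields genuine facet equations.
  have hs : i + j = 0 := by
    by_contra h
    exact hf ⟨hi, hj, Or.inl h⟩
  have hzero : ∀ y ∈ S, y i = 0 ∧ y j = 0 := by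
    intro y hy
    have h := hy.2 _ hij
    dsimp only at h
    rw [hs, hy.1.1] at h
    have h1 := groupCone_nonneg hy.1 i
    have h2 := groupCone_nonneg hy.1 j
    constructor <;> linarith
  have hti : ∀ k, ∀ y ∈ S, y i + y k = y (i + k) := by
    intro k y hy
    obtain ⟨h1, h2⟩ := hzero y hy
    have h3 := groupCone_subadd hy.1 i k
    have h4 := groupCone_subadd hy.1 j (i + k)
    rw [show j + (i + k) = k by rw [← add_assoc, add_comm j, hs, zero_add]] at h4
    linarith
  have htj : ∀ k, ∀ y ∈ S, y j + y k = y (j + k) := by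
    intro k y hy
    obtain ⟨h1, h2⟩ := hzero y hy
    have h3 := groupCone_subadd hy.1 j k
    have h4 := groupCone_subadd hy.1 i (j + k)
    rw [show i + (j + k) = k by rw [← add_assoc, hs, zero_add]] at h4
    linarith
  rw [hs, hx.1]
  by_cases hk : ∃ k : G, k ≠ 0 ∧ k ≠ i ∧ k ≠ j
  · obtain ⟨k, hk0, hki, hkj⟩ := hk
    have hik : i + k ≠ 0 := fun h => hkj (add_left_cancel (h.trans hs.symm))
    have e : j + (i + k) = k := by rw [← add_assoc, add_comm j, hs, zero_add]
    have h1 := hE i k ⟨hi, hk0, Or.inl hik⟩ (hti k)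
    have h2 := hE j (i + k) ⟨hj, hik, Or.inl (by rwa [e])⟩ (htj _)
    rw [e] at h2
    linarith
  -- Here `G = {0, i, j}`. Order 2 is excluded, since `(i, i)` would be a facet pair; in order 3, `2
  -- x i = x j` and `2 x j = x i` do the job.
  · push Not at hk
    by_cases hij' : i = j
    · exfalso
      apply hf
      refine ⟨hi, hj, Or.inr ?_⟩
      rw [Nat.card_eq_two_iff]
      refine ⟨0, i, fun h => hi h.symm, ?_⟩
      ext k
      by_cases h0 : k = 0
      · simp [h0]
      · by_cases h1 : k = i
        · simp [h1]
        · exact absurd (hij' ▸ hk k h0 h1) h1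
    · have hii : i + i ≠ 0 := fun h => hij' (add_left_cancel (h.trans hs.symm))
      have hjj : j + j ≠ 0 := fun h => hij' (add_right_cancel (hs.trans h.symm))
      have e1 : i + i = j := hk _ hii fun h => hi (by simpa using h)
      have e2 : j + j = i := by
        by_contra h
        exact hj (by simpa using hk _ hjj h)
      have h1 := hE i i ⟨hi, hi, Or.inl hii⟩ (hti i)
      have h2 := hE j j ⟨hj, hj, Or.inl hjj⟩ (htj j)
      rw [e1] at h1
      rw [e2] at h2
      linarith

/-! ### The image of a face under the embedding -/

section Monoscopic

variable {G : Type*} [AddCommGroup G] [Finite G] {H : AddSubgroup G} {ρ : G}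

theorem index_pos_of_finite (H : AddSubgroup G) : 0 < H.index :=
  Nat.pos_of_ne_zero AddSubgroup.index_ne_zero_of_finite

theorem exists_eq_add_nsmul (hρ : AddSubgroup.zmultiples (ρ : G ⧸ H) = ⊤) (g : G) :
    ∃ (a : H) (b : ℕ), b < H.index ∧ g = (a : G) + b • ρ := by
  obtain ⟨p, h1, h2⟩ := exists_monoscopic_decomp hρ g
  exact ⟨p.1, p.2, h1, h2⟩

theorem monoscopicEmbedding_coe (hρ : AddSubgroup.zmultiples (ρ : G ⧸ H) = ⊤) (w : H → ℝ)
    (a : H) : monoscopicEmbedding hρ w (a : G) = H.index * w a := by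
  simpa using monoscopicEmbedding_apply hρ w a 0 (index_pos_of_finite H)

/-- The monoscopic embedding at `a + (β + b) ρ`, which reduces to `(a + β ρ) + b ρ`. -/
theorem monoscopicEmbedding_apply_carry (hρ : AddSubgroup.zmultiples (ρ : G ⧸ H) = ⊤) (w : H → ℝ)
    (a : H) (b : ℕ) (hb : b < H.index) :
    monoscopicEmbedding hρ w ((a : G) + (H.index + b) • ρ) =
      H.index * w (a + betaRho H ρ) + b * w (betaRho H ρ) := by
  rw [← monoscopicEmbedding_apply hρ w _ b hb]
  rw [add_nsmul, ← add_assoc]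
  rfl

/-- The endpoint `b = β` is allowed: there `β ρ ∈ H`, and the formula on `H` gives the same value.
-/
theorem monoscopicEmbedding_nsmul (hρ : AddSubgroup.zmultiples (ρ : G ⧸ H) = ⊤) {w : H → ℝ}
    (h0 : w 0 = 0) (b : ℕ) (hb : b ≤ H.index) :
    monoscopicEmbedding hρ w (b • ρ) = b * w (betaRho H ρ) := by
  rcases hb.lt_or_eq with hb | rfl
  · simpa [h0] using monoscopicEmbedding_apply hρ w 0 b hb
  · exact monoscopicEmbedding_coe hρ w (betaRho H ρ)

theorem monoscopicEmbedding_mem_groupCone (hρ : AddSubgroup.zmultiples (ρ : G ⧸ H) = ⊤)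
    {w : H → ℝ} (hw : w ∈ groupCone H) : monoscopicEmbedding hρ w ∈ groupCone G := by
  have hβ : (0 : ℝ) ≤ H.index := Nat.cast_nonneg _
  refine ⟨by simpa [hw.1] using monoscopicEmbedding_coe hρ w 0, fun i j _ => ?_⟩
  obtain ⟨a, b, hb, rfl⟩ := exists_eq_add_nsmul hρ i
  obtain ⟨a', b', hb', rfl⟩ := exists_eq_add_nsmul hρ j
  have e : (a : G) + b • ρ + ((a' : G) + b' • ρ) = ((a + a' : H) : G) + (b + b') • ρ := by
    rw [add_nsmul, AddSubgroup.coe_add]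
    abel
  have h1 := groupCone_subadd hw a a'
  rw [e, monoscopicEmbedding_apply hρ w a b hb, monoscopicEmbedding_apply hρ w a' b' hb']
  rcases lt_or_ge (b + b') H.index with h | h
  · rw [monoscopicEmbedding_apply hρ w _ _ h]
    push_cast
    linarith [mul_le_mul_of_nonneg_left h1 hβ]
  · obtain ⟨c, hc⟩ := Nat.exists_eq_add_of_le h
    -- A carry replaces `β` copies of `w (β ρ)` by a shift of the argument by `β ρ`, which
    -- subadditivity in `H` pays for.
    have h2 := groupCone_subadd hw (a + a') (betaRho H ρ)
    rw [hc, monoscopicEmbedding_apply_carry hρ w _ c (by omega)]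
    have hc' : (b : ℝ) + b' = H.index + c := by exact_mod_cast hc
    have hb'' : (b' : ℝ) = H.index + c - b := by linarith
    rw [hb'']
    linarith [mul_le_mul_of_nonneg_left (h2.trans (add_le_add_left h1 _)) hβ]

theorem exists_groupConeFace_image (hρ : AddSubgroup.zmultiples (ρ : G ⧸ H) = ⊤)
    (F : GroupConeFace H) :
    ∃ F' : GroupConeFace G, F'.carrier = monoscopicEmbedding hρ '' F.carrier := by
  obtain ⟨I, -, hI⟩ := F.isFace
  have hβ : (H.index : ℝ) ≠ 0 := Nat.cast_ne_zero.mpr (index_pos_of_finite H).ne'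
  -- The first two families express additivity along `ρ`; the case `b = β - 1` of the second gives
  -- `x (β ρ) = β x ρ`. The third transports the equations of `F`.
  obtain ⟨F', hF'⟩ := exists_groupConeFace
    ({p : G × G | ∃ (a : H) (b : ℕ), b < H.index ∧ p = ((a : G), b • ρ)} ∪
      {p : G × G | ∃ b : ℕ, b < H.index ∧ p = (b • ρ, ρ)} ∪
      {p : G × G | ∃ q ∈ I, p = ((q.1 : G), (q.2 : G))})
  refine ⟨F', ?_⟩
  rw [hF', hI]
  ext x
  constructor
  · rintro ⟨hx, hxe⟩
    have hA : ∀ (a : H) (b : ℕ), b < H.index → x a + x (b • ρ) = x (a + b • ρ) :=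
      fun a b hb => hxe _ (Or.inl (Or.inl ⟨a, b, hb, rfl⟩))
    have hB : ∀ b : ℕ, b < H.index → x (b • ρ) + x ρ = x (b • ρ + ρ) :=
      fun b hb => hxe _ (Or.inl (Or.inr ⟨b, hb, rfl⟩))
    have hC : ∀ q ∈ I, x q.1 + x q.2 = x (q.1 + q.2) :=
      fun q hq => hxe (q.1, q.2) (Or.inr ⟨q, hq, rfl⟩)
    have hmul : ∀ b : ℕ, b ≤ H.index → x (b • ρ) = b * x ρ := by
      intro b
      induction b with
      | zero => simp [hx.1]
      | succ n ih =>
        intro hn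
        rw [succ_nsmul, ← hB n hn, ih (by omega)]
        push_cast
        ring
    have hcone : (fun a : H => x a / H.index) ∈ groupCone H := by
      refine ⟨by simp [hx.1], fun i j _ => ?_⟩
      dsimp only
      rw [← add_div]
      exact div_le_div_of_nonneg_right (groupCone_subadd hx i j) (Nat.cast_nonneg _)
    refine ⟨fun a => x a / H.index, ⟨hcone, fun p hp => ⟨hcone, ?_⟩⟩, ?_⟩
    · dsimp only
      rw [← add_div, hC p hp]
      rfl
    · ext g
      obtain ⟨a, b, hb, rfl⟩ := exists_eq_add_nsmul hρ g
      rw [monoscopicEmbedding_apply hρ _ a b hb, ← hA a b hb, hmul b hb.le,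
        show x (betaRho H ρ : G) = H.index * x ρ from hmul _ le_rfl]
      field_simp
  · rintro ⟨w, ⟨hw, hwI⟩, rfl⟩
    refine ⟨monoscopicEmbedding_mem_groupCone hρ hw, ?_⟩
    rintro p ((⟨a, b, hb, rfl⟩ | ⟨b, hb, rfl⟩) | ⟨q, hq, rfl⟩)
    · dsimp only
      rw [monoscopicEmbedding_coe, monoscopicEmbedding_nsmul hρ hw.1 b hb.le,
        monoscopicEmbedding_apply hρ w a b hb]
    · have h1 := monoscopicEmbedding_nsmul hρ hw.1 1 (index_pos_of_finite H)
      rw [one_nsmul] at h1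
      dsimp only
      rw [← succ_nsmul, monoscopicEmbedding_nsmul hρ hw.1 b hb.le,
        monoscopicEmbedding_nsmul hρ hw.1 (b + 1) hb, h1]
      push_cast
      ring
    · dsimp only
      rw [← AddSubgroup.coe_add]
      simp only [monoscopicEmbedding_coe]
      rw [← mul_add, (hwI q hq).2]

/-! ### The Kunz subgroup and Kunz poset of the image -/

theorem GroupConeFace.kunzPoset_le_iff (F : GroupConeFace G) (a b : G) :
    F.kunzPoset.le (a : G ⧸ F.kunzSubgroup) (b : G ⧸ F.kunzSubgroup) ↔ F.Rel a b :=
  ⟨fun ⟨_, _, ha, hb, h⟩ => F.rel_congr ha.symm hb.symm h, fun h => ⟨a, b, rfl, rfl, h⟩⟩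

variable {hρ : AddSubgroup.zmultiples (ρ : G ⧸ H) = ⊤} {F : GroupConeFace H}
  {F' : GroupConeFace G}

theorem add_nsmul_mem_kunzSubgroup_iff
    (hF' : F'.carrier = monoscopicEmbedding hρ '' F.carrier) (a : H) {b : ℕ} (hb : b < H.index) :
    (a : G) + b • ρ ∈ F'.kunzSubgroup ↔
      a ∈ F.kunzSubgroup ∧ (b = 0 ∨ betaRho H ρ ∈ F.kunzSubgroup) := by
  have hβ : (0 : ℝ) < H.index := Nat.cast_pos.mpr (index_pos_of_finite H)
  change (∀ x ∈ F'.carrier, x ((a : G) + b • ρ) = 0) ↔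
    (∀ w ∈ F.carrier, w a = 0) ∧ (b = 0 ∨ ∀ w ∈ F.carrier, w (betaRho H ρ) = 0)
  simp only [hF', Set.forall_mem_image, monoscopicEmbedding_apply hρ _ a b hb]
  constructor
  · intro h
    have key : ∀ w ∈ F.carrier, w a = 0 ∧ (b : ℝ) * w (betaRho H ρ) = 0 := by
      intro w hw
      have h1 := mul_nonneg hβ.le (groupCone_nonneg (F.mem_cone hw) a)
      have h2 := mul_nonneg (Nat.cast_nonneg (α := ℝ) b)
        (groupCone_nonneg (F.mem_cone hw) (betaRho H ρ))
      have h3 := h hw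
      refine ⟨(mul_eq_zero.mp (show (H.index : ℝ) * w a = 0 by linarith)).resolve_left hβ.ne',
        by linarith⟩
    refine ⟨fun w hw => (key w hw).1, ?_⟩
    by_cases hb0 : b = 0
    · exact Or.inl hb0
    · exact Or.inr fun w hw =>
        (mul_eq_zero.mp (key w hw).2).resolve_left (Nat.cast_ne_zero.mpr hb0)
  · rintro ⟨h1, h2⟩ w hw
    rcases h2 with rfl | h2
    · simp [h1 w hw]
    · simp [h1 w hw, h2 w hw]

theorem kunzSubgroup_eq_augmentedSubgroup
    (hF' : F'.carrier = monoscopicEmbedding hρ '' F.carrier) :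
    F'.kunzSubgroup = augmentedSubgroup F.kunzSubgroup ρ := by
  have hmap : F.kunzSubgroup.map H.subtype ≤ F'.kunzSubgroup := by
    rintro _ ⟨a, ha, rfl⟩
    simpa using (add_nsmul_mem_kunzSubgroup_iff hF' a (index_pos_of_finite H)).mpr
      ⟨ha, Or.inl rfl⟩
  unfold augmentedSubgroup
  split_ifs with h
  · apply le_antisymm
    · intro g hg
      obtain ⟨a, b, hb, rfl⟩ := exists_eq_add_nsmul hρ g
      exact AddSubgroup.add_mem_sup ⟨a, ((add_nsmul_mem_kunzSubgroup_iff hF' a hb).mp hg).1, rfl⟩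
        (AddSubgroup.nsmul_mem_zmultiples ρ b)
    · rw [sup_le_iff, AddSubgroup.zmultiples_le]
      refine ⟨hmap, fun x hx => ?_⟩
      rw [hF'] at hx
      obtain ⟨w, hw, rfl⟩ := hx
      have h1 := monoscopicEmbedding_nsmul hρ (F.mem_cone hw).1 1 (index_pos_of_finite H)
      rw [one_nsmul, h w hw, mul_zero] at h1
      exact h1
  · refine le_antisymm (fun g hg => ?_) hmap
    obtain ⟨a, b, hb, rfl⟩ := exists_eq_add_nsmul hρ g
    obtain ⟨ha, hb0⟩ := (add_nsmul_mem_kunzSubgroup_iff hF' a hb).mp hg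
    rw [hb0.resolve_right h, zero_nsmul, add_zero]
    exact ⟨a, ha, rfl⟩

/-- If `b ≤ b'`, the multiples of `w (β ρ)` cancel. Otherwise the difference borrows `β ρ`, and the
equation becomes `w a + w (β ρ) + w (a' - a - β ρ) = w a'`. This is equality in a chain of two
subadditivity inequalities, hence in each of them. -/
theorem rel_add_nsmul_iff (hF' : F'.carrier = monoscopicEmbedding hρ '' F.carrier) (a a' : H)
    {b b' : ℕ} (hb : b < H.index) (hb' : b' < H.index) :
    F'.Rel ((a : G) + b • ρ) ((a' : G) + b' • ρ) ↔
      F.Rel a a' ∧ (b ≤ b' ∨ F.Rel (betaRho H ρ) (a' - a)) := by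
  have hβ : (0 : ℝ) < H.index := Nat.cast_pos.mpr (index_pos_of_finite H)
  unfold GroupConeFace.Rel
  simp only [hF', Set.forall_mem_image, monoscopicEmbedding_apply hρ _ a b hb,
    monoscopicEmbedding_apply hρ _ a' b' hb']
  rcases le_or_gt b b' with h | h
  · obtain ⟨c, rfl⟩ := Nat.exists_eq_add_of_le h
    have e : (a' : G) + (b + c) • ρ - ((a : G) + b • ρ) = ((a' - a : H) : G) + c • ρ := by
      rw [add_nsmul, AddSubgroup.coe_sub]
      abel
    simp only [e, monoscopicEmbedding_apply hρ _ (a' - a) c (by omega), h, true_or, and_true]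
    refine forall₂_congr fun w _ => ?_
    push_cast
    constructor
    · intro h1
      apply mul_left_cancel₀ hβ.ne'
      linarith
    · intro h1
      rw [← h1]
      ring
  · obtain ⟨c, hc⟩ := Nat.exists_eq_add_of_le (show b ≤ H.index + b' by omega)
    have e : (a' : G) + b' • ρ - ((a : G) + b • ρ) =
        ((a' - a - betaRho H ρ : H) : G) + c • ρ := by
      have h1 : H.index • ρ + b' • ρ = b • ρ + c • ρ := by rw [← add_nsmul, ← add_nsmul, hc]
      have h2 : ((betaRho H ρ : H) : G) = H.index • ρ := rfl
      rw [AddSubgroup.coe_sub, AddSubgroup.coe_sub, h2, ← sub_eq_zero]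
      rw [← sub_eq_zero] at h1
      rw [← h1]
      abel
    have hc' : (H.index : ℝ) + b' = b + c := by exact_mod_cast hc
    simp only [e, monoscopicEmbedding_apply hρ _ (a' - a - betaRho H ρ) c (by omega),
      h.not_ge, false_or]
    rw [← forall₂_and]
    refine forall₂_congr fun w hw => ?_
    have hw' := F.mem_cone hw
    have h1 := groupCone_subadd hw' a (a' - a)
    have h2 := groupCone_subadd hw' (betaRho H ρ) (a' - a - betaRho H ρ)
    rw [add_sub_cancel] at h1 h2
    have hb'' : (b' : ℝ) = b + c - H.index := by linarith
    rw [hb'']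
    constructor
    · intro h3
      have h4 : w a + (w (betaRho H ρ) + w (a' - a - betaRho H ρ)) = w a' := by
        apply mul_left_cancel₀ hβ.ne'
        linarith
      constructor <;> linarith
    · rintro ⟨h3, h4⟩
      rw [← h3, ← h4]
      ring

theorem rel_iff_augmentedLE (hF' : F'.carrier = monoscopicEmbedding hρ '' F.carrier) (g g' : G) :
    F'.Rel g g' ↔ augmentedLE F.kunzPoset ρ (g : G ⧸ augmentedSubgroup F.kunzSubgroup ρ)
      (g' : G ⧸ augmentedSubgroup F.kunzSubgroup ρ) := by
  have hK := kunzSubgroup_eq_augmentedSubgroup hF'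
  have hcongr : ∀ {c d : G}, (c : G ⧸ augmentedSubgroup F.kunzSubgroup ρ) = d ↔
      (c : G ⧸ F'.kunzSubgroup) = d := by
    intro c d
    rw [QuotientAddGroup.eq, QuotientAddGroup.eq, hK]
  unfold augmentedLE
  simp only [hcongr, F.kunzPoset_le_iff]
  obtain ⟨a, b, hb, rfl⟩ := exists_eq_add_nsmul hρ g
  obtain ⟨a', b', hb', rfl⟩ := exists_eq_add_nsmul hρ g'
  split_ifs with h
  -- Since `b ρ` lies in the Kunz subgroup, every class has a representative in `H`; with `b = b' =
  -- 0` the extra condition is vacuous.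
  · have hmem : ∀ (a : H) (b : ℕ), b < H.index →
        (((a : G) + b • ρ : G) : G ⧸ F'.kunzSubgroup) = ((a : G) : G ⧸ F'.kunzSubgroup) := by
      intro a b hb
      rw [eq_comm, QuotientAddGroup.eq, neg_add_cancel_left]
      simpa using (add_nsmul_mem_kunzSubgroup_iff hF' 0 hb).mpr ⟨zero_mem _, Or.inr h⟩
    constructor
    · intro h1
      exact ⟨a, a', hmem a b hb, hmem a' b' hb', ((rel_add_nsmul_iff hF' a a' hb hb').mp h1).1⟩
    · rintro ⟨c, c', hc, hc', h1⟩
      have h2 := (rel_add_nsmul_iff hF' c c' (index_pos_of_finite H)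
        (index_pos_of_finite H)).mpr ⟨h1, Or.inl le_rfl⟩
      rw [zero_nsmul, add_zero, add_zero] at h2
      exact F'.rel_congr hc.symm hc'.symm h2
  · constructor
    · intro h1
      exact ⟨a, a', b, b', hb, hb', rfl, rfl, (rel_add_nsmul_iff hF' a a' hb hb').mp h1⟩
    · rintro ⟨c, c', d, d', hd, hd', hc, hc', h1⟩
      exact F'.rel_congr hc.symm hc'.symm ((rel_add_nsmul_iff hF' c c' hd hd').mpr h1)

end Monoscopic

theorem theoremt {G : Type*} [AddCommGroup G] [Finite G] (H : AddSubgroup G) (ρ : G)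
    (hρ : AddSubgroup.zmultiples (ρ : G ⧸ H) = ⊤) :
    (∃ F' : GroupConeFace G, F'.carrier = monoscopicEmbedding hρ '' groupCone H) ∧
    ∀ F : GroupConeFace H, ∃ F' : GroupConeFace G,
      F'.carrier = monoscopicEmbedding hρ '' F.carrier ∧
      F'.kunzSubgroup = augmentedSubgroup F.kunzSubgroup ρ ∧
      ∀ g g' : G,
        F'.kunzPoset.le (g : G ⧸ F'.kunzSubgroup) (g' : G ⧸ F'.kunzSubgroup) ↔
          augmentedLE F.kunzPoset ρ (g : G ⧸ augmentedSubgroup F.kunzSubgroup ρ)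
            (g' : G ⧸ augmentedSubgroup F.kunzSubgroup ρ) := by
  refine ⟨exists_groupConeFace_image hρ ⟨groupCone H, ∅, by simp, by simp⟩, fun F => ?_⟩
  obtain ⟨F', hF'⟩ := exists_groupConeFace_image hρ F
  exact ⟨F', hF', kunzSubgroup_eq_augmentedSubgroup hF', fun g g' =>
    (F'.kunzPoset_le_iff g g').trans (rel_iff_augmentedLE hF' g g')⟩
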